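/- Let $\mathcal A$ be a Desargues affine plane: a set of points and a set of lines with an incidence relation such that two distinct points lie on exactly one line, through a point off a line $\ell$ there is exactly one line not meeting $\ell$, there are three non-collinear points, and Desargues' axiom holds (for triangles $ABC$, $A'B'C'$ with $AA',BB',CC'$ distinct and either parallel or concurrent, $AB\parallel A'B'$ and $BC\parallel B'C'$ imply $AC\parallel A'C'$). Let $O\ne I$ be points, let $\ell^{OI}$ be the line joining them, and let $B_1$ be a point not on $\ell^{OI}$. For points $A,B$ of $\ell^{OI}$ define the points $A+B$ and $A\cdot B$ of $\ell^{OI}$ as follows. * Sum: let $P_1$ be the intersection of the parallel to $\ell^{OI}$ through $B_1$ with the parallel to $OB_1$ through $A$; then $A+B$ is the intersection of $\ell^{OI}$ with the parallel to $BB_1$ through $P_1$. * Product: let $P_1$ be the intersection of the parallel to $IB_1$ through $A$ with the line $OB_1$; then $A\cdot B$ is the intersection of $\ell^{OI}$ with the parallel to $BB_1$ through $P_1$. Here $-A$ is the point with $A+(-A)=O$, $A-B=A+(-B)$, and, for $A\neq O$, $A^{-1}$ is the point with $A\cdot A^{-1}=I$. For $A,B,C\in\ell^{OI}$ with $B\ne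 C$ the ratio of three points is $r(A,B;C)=(B-C)^{-1}\cdot(A-C)$, and for $P\in\ell^{OI}$ the inversion with the point $P$ is the map $j_P:\ell^{OI}\to\ell^{OI}$, $j_P(A)=P\cdot A$. **Theorem.** The ratio of three points is invariant under inversion with a given point $P\neq O$: for every choice of $B_1$, all $P\in\ell^{OI}$ with $P\ne O$ and all $A,B,C\in\ell^{OI}$ with $B\neq C$, one has $j_P(B)\ne j_P(C)$ and $$r\bigl(j_P(A),j_P(B);j_P(C)\bigr)=r(A,B;C).$$ -/

import Mathlib

/-- An affine plane: an incidence structure of points and lines such that two distinct points lie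
on exactly one line, Playfair's parallel axiom holds, and there are three non-collinear points. -/
structure AffinePlane (Point : Type*) (Line : Type*) where
  /-- `Inc X l`: the point `X` lies on the line `l`. -/
  Inc : Point → Line → Prop
  existsUnique_line : ∀ P Q : Point, P ≠ Q → ∃! l : Line, Inc P l ∧ Inc Q l
  existsUnique_disjoint : ∀ (P : Point) (l : Line), ¬ Inc P l →
    ∃! m : Line, Inc P m ∧ ∀ X : Point, ¬ (Inc X l ∧ Inc X m)
  exists_triangle : ∃ P Q R : Point, P ≠ Q ∧ P ≠ R ∧ Q ≠ R ∧
    ¬ ∃ l : Line, Inc P l ∧ Inc Q l ∧ Inc R l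

namespace AffinePlane

variable {Point : Type*} {Line : Type*} (𝒜 : AffinePlane Point Line)

/-- Two lines are parallel if they are equal or have no common point. -/
def Parallel (l m : Line) : Prop :=
  l = m ∨ ∀ X : Point, ¬ (𝒜.Inc X l ∧ 𝒜.Inc X m)

/-- `l` is the line through the two distinct points `P` and `Q`. -/
def IsJoin (P Q : Point) (l : Line) : Prop :=
  P ≠ Q ∧ 𝒜.Inc P l ∧ 𝒜.Inc Q l

variable {𝒜}

theorem line_eq {P Q : Point} (h : P ≠ Q) {l m : Line} (hPl : 𝒜.Inc P l) (hQl : 𝒜.Inc Q l)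
    (hPm : 𝒜.Inc P m) (hQm : 𝒜.Inc Q m) : l = m :=
  (𝒜.existsUnique_line P Q h).unique ⟨hPl, hQl⟩ ⟨hPm, hQm⟩

theorem Parallel.symm {l m : Line} (h : 𝒜.Parallel l m) : 𝒜.Parallel m l := by
  rcases h with h | h
  · exact Or.inl h.symm
  · exact Or.inr fun X hX => h X ⟨hX.2, hX.1⟩

theorem Parallel.eq_of_inc {l m : Line} (h : 𝒜.Parallel l m) {X : Point} (hl : 𝒜.Inc X l)
    (hm : 𝒜.Inc X m) : l = m := by
  rcases h with h | h
  · exact h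
  · exact absurd ⟨hl, hm⟩ (h X)

variable (𝒜)

theorem existsUnique_parallel (P : Point) (l : Line) :
    ∃! m : Line, 𝒜.Inc P m ∧ 𝒜.Parallel m l := by
  by_cases h : 𝒜.Inc P l
  · exact ⟨l, ⟨h, Or.inl rfl⟩, fun m hm => hm.2.eq_of_inc hm.1 h⟩
  · obtain ⟨m, ⟨hm1, hm2⟩, hm3⟩ := 𝒜.existsUnique_disjoint P l h
    refine ⟨m, ⟨hm1, Or.inr fun X hX => hm2 X ⟨hX.2, hX.1⟩⟩, fun n hn => hm3 n ⟨hn.1, ?_⟩⟩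
    rcases hn.2 with e | e
    · exact absurd (e ▸ hn.1) h
    · exact fun X hX => e X ⟨hX.2, hX.1⟩

/-- The line through two distinct points. -/
noncomputable def join (P Q : Point) (h : P ≠ Q) : Line :=
  (𝒜.existsUnique_line P Q h).choose

/-- The line through `P` parallel to `l`. -/
noncomputable def par (P : Point) (l : Line) : Line :=
  (𝒜.existsUnique_parallel P l).choose

theorem join_left {P Q : Point} (h : P ≠ Q) : 𝒜.Inc P (𝒜.join P Q h) :=
  (𝒜.existsUnique_line P Q h).choose_spec.1.1

theorem join_right {P Q : Point} (h : P ≠ Q) : 𝒜.Inc Q (𝒜.join P Q h) :=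
  (𝒜.existsUnique_line P Q h).choose_spec.1.2

theorem inc_par (P : Point) (l : Line) : 𝒜.Inc P (𝒜.par P l) :=
  (𝒜.existsUnique_parallel P l).choose_spec.1.1

theorem par_parallel (P : Point) (l : Line) : 𝒜.Parallel (𝒜.par P l) l :=
  (𝒜.existsUnique_parallel P l).choose_spec.1.2

variable {𝒜}

theorem Parallel.trans {l m n : Line} (h : 𝒜.Parallel l m) (h' : 𝒜.Parallel m n) :
    𝒜.Parallel l n := by
  by_cases hX : ∃ X, 𝒜.Inc X l ∧ 𝒜.Inc X n
  · obtain ⟨X, hl, hn⟩ := hX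
    exact Or.inl ((𝒜.existsUnique_parallel X m).unique ⟨hl, h⟩ ⟨hn, h'.symm⟩)
  · exact Or.inr fun X hX' => hX ⟨X, hX'⟩

theorem existsUnique_meet {l m : Line} (h : ¬ 𝒜.Parallel l m) :
    ∃! X : Point, 𝒜.Inc X l ∧ 𝒜.Inc X m := by
  unfold Parallel at h
  push Not at h
  obtain ⟨hne, X, hX⟩ := h
  refine ⟨X, hX, fun Y hY => ?_⟩
  by_contra hYX
  exact hne (line_eq hYX hY.1 hX.1 hY.2 hX.2)

variable (𝒜)

/-- The common point of two non-parallel lines. -/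
noncomputable def meet (l m : Line) (h : ¬ 𝒜.Parallel l m) : Point :=
  (existsUnique_meet h).choose

theorem meet_left {l m : Line} (h : ¬ 𝒜.Parallel l m) : 𝒜.Inc (𝒜.meet l m h) l :=
  (existsUnique_meet h).choose_spec.1.1

theorem meet_right {l m : Line} (h : ¬ 𝒜.Parallel l m) : 𝒜.Inc (𝒜.meet l m h) m :=
  (existsUnique_meet h).choose_spec.1.2

variable {𝒜} in
theorem meet_eq {l m : Line} (h : ¬ 𝒜.Parallel l m) {X : Point} (hl : 𝒜.Inc X l)
    (hm : 𝒜.Inc X m) : 𝒜.meet l m h = X :=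
  (existsUnique_meet h).unique ⟨𝒜.meet_left h, 𝒜.meet_right h⟩ ⟨hl, hm⟩

variable {𝒜} in
theorem par_eq {P : Point} {l m : Line} (hP : 𝒜.Inc P m) (h : 𝒜.Parallel m l) :
    𝒜.par P l = m :=
  (𝒜.existsUnique_parallel P l).unique ⟨𝒜.inc_par P l, 𝒜.par_parallel P l⟩ ⟨hP, h⟩

end AffinePlane

/-- A Desargues affine plane: an affine plane satisfying Desargues' axiom, for triangles `ABC` and
`A'B'C'` whose vertices are joined by three parallel or three concurrent lines. -/
structure DesarguesAffinePlane (Point : Type*) (Line : Type*) extends AffinePlane Point Line where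
  desargues : ∀ (A B C A' B' C' : Point) (a b c ab ab' bc bc' ac ac' : Line),
    toAffinePlane.IsJoin A A' a → toAffinePlane.IsJoin B B' b → toAffinePlane.IsJoin C C' c →
    toAffinePlane.IsJoin A B ab → toAffinePlane.IsJoin A' B' ab' →
    toAffinePlane.IsJoin B C bc → toAffinePlane.IsJoin B' C' bc' →
    toAffinePlane.IsJoin A C ac → toAffinePlane.IsJoin A' C' ac' →
    [a, b, c, ac, ac'].Nodup → ab ≠ ab' → bc ≠ bc' →
    ((toAffinePlane.Parallel a b ∧ toAffinePlane.Parallel b c) ∨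
      ∃ V : Point, Inc V a ∧ Inc V b ∧ Inc V c) →
    toAffinePlane.Parallel ab ab' → toAffinePlane.Parallel bc bc' →
    toAffinePlane.Parallel ac ac'

/-- The data for calculating with the points of a line `OI`: the line `line`, two distinct points
`O`, `I` on it (the future zero and unit), and the auxiliary point `B₁` off the line with which sums
and products are constructed. (In a Desargues affine plane the results do not depend on `B₁`;
statements are made for every choice of it.) -/
structure LineFrame {Point : Type*} {Line : Type*} (𝒜 : AffinePlane Point Line) where
  line : Line
  O : Point
  I : Point
  B₁ : Point
  O_ne_I : O ≠ I
  O_inc : 𝒜.Inc O line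
  I_inc : 𝒜.Inc I line
  B₁_not_inc : ¬ 𝒜.Inc B₁ line

namespace LineFrame

open AffinePlane

variable {Point : Type*} {Line : Type*} {𝒜 : AffinePlane Point Line} (F : LineFrame 𝒜)

/-- The points of the line `OI`. -/
def Pt : Type _ := {X : Point // 𝒜.Inc X F.line}

/-- The point `O` is the zero. -/
instance : Zero F.Pt := ⟨⟨F.O, F.O_inc⟩⟩

/-- The point `I` is the unit. -/
instance : One F.Pt := ⟨⟨F.I, F.I_inc⟩⟩

variable {F}

theorem ne_B₁ {X : Point} (hX : 𝒜.Inc X F.line) : X ≠ F.B₁ :=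
  fun h => F.B₁_not_inc (h ▸ hX)

theorem join_B₁_not_parallel {X : Point} (hX : 𝒜.Inc X F.line) :
    ¬ 𝒜.Parallel (𝒜.join X F.B₁ (ne_B₁ hX)) F.line := fun h =>
  F.B₁_not_inc (h.eq_of_inc (𝒜.join_left _) hX ▸ 𝒜.join_right (ne_B₁ hX))

theorem par_join_B₁_not_parallel {X : Point} (hX : 𝒜.Inc X F.line) (P₁ : Point) :
    ¬ 𝒜.Parallel (𝒜.par P₁ (𝒜.join X F.B₁ (ne_B₁ hX))) F.line := fun h =>
  join_B₁_not_parallel hX ((𝒜.par_parallel _ _).symm.trans h)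

variable (F)

/-- The line `O B₁`. -/
noncomputable def lineOB₁ : Line := 𝒜.join F.O F.B₁ (ne_B₁ F.O_inc)

/-- The line `I B₁`. -/
noncomputable def lineIB₁ : Line := 𝒜.join F.I F.B₁ (ne_B₁ F.I_inc)

theorem add_step (A : Point) :
    ¬ 𝒜.Parallel (𝒜.par F.B₁ F.line) (𝒜.par A F.lineOB₁) := fun h =>
  join_B₁_not_parallel F.O_inc
    ((((𝒜.par_parallel _ _).symm.trans h).trans (𝒜.par_parallel _ _)).symm)

theorem I_not_inc : ¬ 𝒜.Inc F.I F.lineOB₁ := fun h =>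
  F.B₁_not_inc (line_eq F.O_ne_I (𝒜.join_left _) h F.O_inc F.I_inc ▸
    𝒜.join_right (ne_B₁ F.O_inc))

theorem mul_step (A : Point) : ¬ 𝒜.Parallel (𝒜.par A F.lineIB₁) F.lineOB₁ := fun h => by
  have h1 : 𝒜.Parallel F.lineIB₁ F.lineOB₁ := (𝒜.par_parallel _ _).symm.trans h
  have h2 : F.lineIB₁ = F.lineOB₁ := h1.eq_of_inc (𝒜.join_right _) (𝒜.join_right _)
  exact F.I_not_inc (h2 ▸ 𝒜.join_left (ne_B₁ F.I_inc))

/-- First step of the addition: `P₁` is the intersection of the parallel to `OI` through `B₁` with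
the parallel to `O B₁` through `A`. -/
noncomputable def addP₁ (A : Point) : Point :=
  𝒜.meet (𝒜.par F.B₁ F.line) (𝒜.par A F.lineOB₁) (F.add_step A)

/-- First step of the multiplication: `P₁` is the intersection of the parallel to `I B₁` through `A`
with the line `O B₁`. -/
noncomputable def mulP₁ (A : Point) : Point :=
  𝒜.meet (𝒜.par A F.lineIB₁) F.lineOB₁ (F.mul_step A)

/-- Last step of both constructions: the intersection with `OI` of the parallel to `B B₁`
through `P₁`. -/
noncomputable def close (P₁ : Point) (B : F.Pt) : F.Pt :=
  ⟨𝒜.meet (𝒜.par P₁ (𝒜.join B.1 F.B₁ (ne_B₁ B.2))) F.line (par_join_B₁_not_parallel B.2 P₁),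
    𝒜.meet_right _⟩

/-- The sum `A + B` of points of the line `OI`. -/
noncomputable instance : Add F.Pt := ⟨fun A B => F.close (F.addP₁ A.1) B⟩

/-- The product `A · B` of points of the line `OI`. -/
noncomputable instance : Mul F.Pt := ⟨fun A B => F.close (F.mulP₁ A.1) B⟩

theorem exists_close_eq {P₁ : Point} (h : ¬ 𝒜.Inc P₁ F.line) (C : F.Pt) :
    ∃ X : F.Pt, F.close P₁ X = C := by
  have hne : C.1 ≠ P₁ := fun e => h (e ▸ C.2)
  have hk : ¬ 𝒜.Parallel (𝒜.par F.B₁ (𝒜.join C.1 P₁ hne)) F.line := fun hp =>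
    h (((𝒜.par_parallel _ _).symm.trans hp).eq_of_inc (𝒜.join_left hne) C.2 ▸
      𝒜.join_right hne)
  refine ⟨⟨𝒜.meet _ _ hk, 𝒜.meet_right hk⟩,
    Subtype.ext (meet_eq (par_join_B₁_not_parallel (𝒜.meet_right hk) P₁) ?_ C.2)⟩
  have e : 𝒜.join (𝒜.meet _ _ hk) F.B₁ (ne_B₁ (𝒜.meet_right hk)) =
      𝒜.par F.B₁ (𝒜.join C.1 P₁ hne) :=
    line_eq (ne_B₁ (𝒜.meet_right hk)) (𝒜.join_left _) (𝒜.join_right _) (𝒜.meet_left hk)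
      (𝒜.inc_par _ _)
  have e' : 𝒜.par P₁ (𝒜.join (𝒜.meet _ _ hk) F.B₁ (ne_B₁ (𝒜.meet_right hk))) =
      𝒜.join C.1 P₁ hne :=
    par_eq (𝒜.join_right hne) (by rw [e]; exact (𝒜.par_parallel _ _).symm)
  rw [e']
  exact 𝒜.join_left hne

theorem exists_add_eq_zero (A : F.Pt) : ∃ X : F.Pt, A + X = 0 := by
  refine F.exists_close_eq (fun h => ?_) 0
  have h1 := (𝒜.par_parallel F.B₁ F.line).eq_of_inc (𝒜.meet_left (F.add_step A.1)) h
  exact F.B₁_not_inc (h1 ▸ 𝒜.inc_par F.B₁ F.line)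

theorem exists_mul_eq_one (A : F.Pt) (hA : A ≠ 0) : ∃ X : F.Pt, A * X = 1 := by
  refine F.exists_close_eq (fun h => ?_) 1
  have hO : F.mulP₁ A.1 = F.O := by
    by_contra hne
    exact F.B₁_not_inc (line_eq hne (𝒜.meet_right (F.mul_step A.1)) (𝒜.join_left _) h F.O_inc ▸
      𝒜.join_right (ne_B₁ F.O_inc))
  have h1 : 𝒜.Inc F.O (𝒜.par A.1 F.lineIB₁) := hO ▸ 𝒜.meet_left (F.mul_step A.1)
  have h2 : A.1 ≠ F.O := fun e => hA (Subtype.ext e)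
  have h3 : 𝒜.par A.1 F.lineIB₁ = F.line := line_eq h2 (𝒜.inc_par _ _) h1 A.2 F.O_inc
  exact join_B₁_not_parallel F.I_inc (h3 ▸ (𝒜.par_parallel A.1 F.lineIB₁).symm)

/-- The opposite point: `A + (-A) = O`. -/
noncomputable instance : Neg F.Pt := ⟨fun A => (F.exists_add_eq_zero A).choose⟩

/-- The difference `A - B = A + (-B)`. -/
noncomputable instance : Sub F.Pt := ⟨fun A B => A + -B⟩

open Classical in
/-- The inverse point of `A ≠ O`: `A · A⁻¹ = I`. (The value at `O` is irrelevant.) -/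
noncomputable instance : Inv F.Pt :=
  ⟨fun A => if h : A ≠ 0 then (F.exists_mul_eq_one A h).choose else 0⟩

variable {F}

/-- The ratio `r(A, B; C) = (B - C)⁻¹ (A - C)` of three points of the line `OI`, where `B ≠ C`. -/
noncomputable def ratio (A B C : F.Pt) : F.Pt := (B - C)⁻¹ * (A - C)

/-- The inversion `j_P(A) = P · A` of the line `OI`. -/
noncomputable def inversion (P : F.Pt) : F.Pt → F.Pt := fun A => P * A

end LineFrame

/-!
For `A ≠ O`, left multiplication by `A` is the restriction to `OI` of the homothety with centre `O`
that sends `I` to `A`, and left addition of `A` is the restriction of the translation that sends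
`O` to `A`. Two identities follow from Desargues' axiom.

* Associativity, `mul_assoc_of_ne_zero`. A homothety with centre `O` acts on the two lines `OI` and
  `O B₁`. That its action is consistent is the statement about quadrangles with vertices on two
  lines `sameDir_of_two_lines`, obtained by transporting directions through an auxiliary point on
  a third line through `O`.
* Left distributivity, `mul_add_of_ne_zero`. The homothety of `P` carries the construction of
  `X + Y` to a construction of `P · X + P · Y` that uses the image of `B₁` as its auxiliary point.
  Desargues' axiom for three parallel lines replaces this auxiliary point by `B₁`.

Hence `j_P` commutes with differences, and the invariance of the ratio becomes
`(P · X)⁻¹ · (P · Y) = X⁻¹ · Y` for `X = B - C` and `Y = A - C`. Both sides give `P · Y` when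
multiplied on the left by `P · X`, and left multiplication by a nonzero point is injective.
Neither commutativity of addition nor right distributivity enters.
-/

namespace AffinePlane

variable {Point : Type*} {Line : Type*} {𝒜 : AffinePlane Point Line}

/-! ### Directions of pairs of points -/

variable (𝒜) in
/-- The pairs `A, B` and `C, D` lie on parallel lines. When `A ≠ B` and `C ≠ D` this says
`AB ∥ CD`; it holds trivially when `A = B` or `C = D`. -/
def SameDir (A B C D : Point) : Prop :=
  ∃ l m : Line, 𝒜.Inc A l ∧ 𝒜.Inc B l ∧ 𝒜.Inc C m ∧ 𝒜.Inc D m ∧ 𝒜.Parallel l m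

theorem Parallel.refl (l : Line) : 𝒜.Parallel l l := Or.inl rfl

namespace SameDir

variable {A B C D E G : Point}

theorem symm (h : 𝒜.SameDir A B C D) : 𝒜.SameDir C D A B := by
  obtain ⟨l, m, hA, hB, hC, hD, hp⟩ := h
  exact ⟨m, l, hC, hD, hA, hB, hp.symm⟩

theorem flip (h : 𝒜.SameDir A B C D) : 𝒜.SameDir B A D C := by
  obtain ⟨l, m, hA, hB, hC, hD, hp⟩ := h
  exact ⟨l, m, hB, hA, hD, hC, hp⟩

theorem trans (h : 𝒜.SameDir A B C D) (h' : 𝒜.SameDir C D E G) (hne : C ≠ D) :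
    𝒜.SameDir A B E G := by
  obtain ⟨l, m, hA, hB, hC, hD, hp⟩ := h
  obtain ⟨l', m', hC', hD', hE, hG, hp'⟩ := h'
  obtain rfl := line_eq hne hC hD hC' hD'
  exact ⟨l, m', hA, hB, hE, hG, hp.trans hp'⟩

theorem of_inc {l : Line} (hA : 𝒜.Inc A l) (hB : 𝒜.Inc B l) (hC : 𝒜.Inc C l)
    (hD : 𝒜.Inc D l) : 𝒜.SameDir A B C D :=
  ⟨l, l, hA, hB, hC, hD, .refl l⟩

theorem parallel (h : 𝒜.SameDir A B C D) (hAB : A ≠ B) (hCD : C ≠ D) {l m : Line}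
    (hA : 𝒜.Inc A l) (hB : 𝒜.Inc B l) (hC : 𝒜.Inc C m) (hD : 𝒜.Inc D m) :
    𝒜.Parallel l m := by
  obtain ⟨l', m', hA', hB', hC', hD', hp⟩ := h
  obtain rfl := line_eq hAB hA hB hA' hB'
  obtain rfl := line_eq hCD hC hD hC' hD'
  exact hp

/-- If `CD ∥ AB` and `CD ∥ AE`, where `B` and `E` lie on a line that misses `A`, then `B = E`. -/
theorem eq_of_inc (h : 𝒜.SameDir C D A B) (h' : 𝒜.SameDir C D A E) (hCD : C ≠ D) {l : Line}
    (hA : ¬ 𝒜.Inc A l) (hB : 𝒜.Inc B l) (hE : 𝒜.Inc E l) : B = E := by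
  obtain ⟨k, m, hC, hD, hAm, hBm, hp⟩ := h
  obtain ⟨k', m', hC', hD', hAm', hEm', hp'⟩ := h'
  obtain rfl := line_eq hCD hC hD hC' hD'
  obtain rfl := (hp.symm.trans hp').eq_of_inc hAm hAm'
  by_contra hne
  exact hA (line_eq hne hBm hEm' hB hE ▸ hAm)

end SameDir

theorem exists_inc_sameDir {A B C : Point} {l : Line} (hB : 𝒜.Inc B l) (hA : ¬ 𝒜.Inc A l)
    {k : Line} (hk : 𝒜.Parallel k l) : ∃ X, 𝒜.Inc X k ∧ 𝒜.SameDir A B C X := by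
  have hne : A ≠ B := fun e => hA (e ▸ hB)
  have hn : ¬ 𝒜.Parallel (𝒜.par C (𝒜.join A B hne)) k := fun hp =>
    hA ((((𝒜.par_parallel _ _).symm.trans hp).trans hk).eq_of_inc (𝒜.join_right hne) hB ▸
      𝒜.join_left hne)
  exact ⟨𝒜.meet _ _ hn, 𝒜.meet_right hn, _, _, 𝒜.join_left hne, 𝒜.join_right hne,
    𝒜.inc_par _ _, 𝒜.meet_left hn, (𝒜.par_parallel _ _).symm⟩

end AffinePlane

namespace DesarguesAffinePlane

open AffinePlane

variable {Point : Type*} {Line : Type*} {𝒜 : DesarguesAffinePlane Point Line}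

/-! ### Forms of Desargues' axiom -/

/-- Desargues' axiom without the requirement that corresponding vertices or sides be distinct. Here
`a`, `b`, `c` are the lines along which the vertices correspond, and no vertex lies on the line of
another. If the triangles share a vertex then they coincide, so the conclusion still holds. -/
theorem sameDir_of_desargues {A B C A' B' C' : Point} {a b c : Line}
    (hA : 𝒜.Inc A a) (hA' : 𝒜.Inc A' a) (hB : 𝒜.Inc B b) (hB' : 𝒜.Inc B' b)
    (hC : 𝒜.Inc C c) (hC' : 𝒜.Inc C' c)
    (hAb : ¬ 𝒜.Inc A b) (hAc : ¬ 𝒜.Inc A c) (hBa : ¬ 𝒜.Inc B a) (hBc : ¬ 𝒜.Inc B c)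
    (hCa : ¬ 𝒜.Inc C a) (hCb : ¬ 𝒜.Inc C b)
    (hA'b : ¬ 𝒜.Inc A' b) (hA'c : ¬ 𝒜.Inc A' c)
    (hB'c : ¬ 𝒜.Inc B' c)
    (habc : (𝒜.Parallel a b ∧ 𝒜.Parallel b c) ∨ ∃ V, 𝒜.Inc V a ∧ 𝒜.Inc V b ∧ 𝒜.Inc V c)
    (hAB : 𝒜.SameDir A B A' B') (hBC : 𝒜.SameDir B C B' C') :
    𝒜.SameDir A C A' C' := by
  have nAB : A ≠ B := fun e => hAb (e ▸ hB)
  have nBC : B ≠ C := fun e => hBc (e ▸ hC)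
  have nAC : A ≠ C := fun e => hAc (e ▸ hC)
  have nAB' : A' ≠ B' := fun e => hA'b (e ▸ hB')
  have nBC' : B' ≠ C' := fun e => hB'c (e ▸ hC')
  have nAC' : A' ≠ C' := fun e => hA'c (e ▸ hC')
  have refl_AB : 𝒜.SameDir A B A B := .of_inc (𝒜.join_left nAB) (𝒜.join_right nAB)
    (𝒜.join_left nAB) (𝒜.join_right nAB)
  have refl_BC : 𝒜.SameDir B C B C := .of_inc (𝒜.join_left nBC) (𝒜.join_right nBC)
    (𝒜.join_left nBC) (𝒜.join_right nBC)
  by_cases eB : B = B'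
  · subst eB
    have eA : A = A' := refl_AB.flip.eq_of_inc hAB.flip nAB.symm hBa hA hA'
    have eC : C = C' := refl_BC.eq_of_inc hBC nBC hBc hC hC'
    subst eA eC
    exact .of_inc (𝒜.join_left nAC) (𝒜.join_right nAC) (𝒜.join_left nAC) (𝒜.join_right nAC)
  have eA : A ≠ A' := by
    rintro rfl
    exact eB (refl_AB.eq_of_inc hAB nAB hAb hB hB')
  have eC : C ≠ C' := by
    rintro rfl
    exact eB (refl_BC.flip.eq_of_inc hBC.flip nBC.symm hCb hB hB')
  by_cases hac : 𝒜.join A C nAC = 𝒜.join A' C' nAC'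
  · exact .of_inc (𝒜.join_left nAC) (𝒜.join_right nAC) (hac ▸ 𝒜.join_left nAC')
      (hac ▸ 𝒜.join_right nAC')
  refine ⟨𝒜.join A C nAC, 𝒜.join A' C' nAC', 𝒜.join_left _, 𝒜.join_right _, 𝒜.join_left _,
    𝒜.join_right _, 𝒜.desargues A B C A' B' C' a b c (𝒜.join A B nAB) (𝒜.join A' B' nAB')
      (𝒜.join B C nBC) (𝒜.join B' C' nBC') _ _ ⟨eA, hA, hA'⟩ ⟨eB, hB, hB'⟩ ⟨eC, hC, hC'⟩
      ⟨nAB, 𝒜.join_left _, 𝒜.join_right _⟩ ⟨nAB', 𝒜.join_left _, 𝒜.join_right _⟩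
      ⟨nBC, 𝒜.join_left _, 𝒜.join_right _⟩ ⟨nBC', 𝒜.join_left _, 𝒜.join_right _⟩
      ⟨nAC, 𝒜.join_left _, 𝒜.join_right _⟩ ⟨nAC', 𝒜.join_left _, 𝒜.join_right _⟩
      ?_ ?_ ?_ habc ?_ ?_⟩
  · have h1 : a ≠ b := fun e => hAb (e ▸ hA)
    have h2 : a ≠ c := fun e => hAc (e ▸ hA)
    have h3 : b ≠ c := fun e => hBc (e ▸ hB)
    have h4 : a ≠ 𝒜.join A C nAC := fun e => hCa (e ▸ 𝒜.join_right nAC)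
    have h5 : a ≠ 𝒜.join A' C' nAC' := fun e => by
      have hV : 𝒜.Inc C' a := e ▸ 𝒜.join_right nAC'
      rcases habc with ⟨p, q⟩ | ⟨V, Va, Vb, Vc⟩
      · exact h2 ((p.trans q).eq_of_inc hV hC')
      · have : C' = V := by
          by_contra hne
          exact h2 (line_eq hne hV Va hC' Vc)
        subst this
        exact hCb ((hBC.parallel nBC nBC' (𝒜.join_left nBC) (𝒜.join_right nBC)
          hB' Vb).eq_of_inc (𝒜.join_left nBC) hB ▸ 𝒜.join_right nBC)
    have h6 : b ≠ 𝒜.join A C nAC := fun e => hAb (e ▸ 𝒜.join_left nAC)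
    have h7 : b ≠ 𝒜.join A' C' nAC' := fun e => hA'b (e ▸ 𝒜.join_left nAC')
    have h8 : c ≠ 𝒜.join A C nAC := fun e => hAc (e ▸ 𝒜.join_left nAC)
    have h9 : c ≠ 𝒜.join A' C' nAC' := fun e => hA'c (e ▸ 𝒜.join_left nAC')
    simp [h1, h2, h3, h4, h5, h6, h7, h8, h9, hac]
  · intro e
    exact hBa (line_eq eA (𝒜.join_left nAB) (e ▸ 𝒜.join_left nAB') hA hA' ▸ 𝒜.join_right nAB)
  · intro e
    exact hCb (line_eq eB (𝒜.join_left nBC) (e ▸ 𝒜.join_left nBC') hB hB' ▸ 𝒜.join_right nBC)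
  · exact hAB.parallel nAB nAB' (𝒜.join_left _) (𝒜.join_right _) (𝒜.join_left _)
      (𝒜.join_right _)
  · exact hBC.parallel nBC nBC' (𝒜.join_left _) (𝒜.join_right _) (𝒜.join_left _)
      (𝒜.join_right _)

theorem not_inc_of_ne {O X : Point} {a b : Line} (hab : a ≠ b) (hOa : 𝒜.Inc O a)
    (hOb : 𝒜.Inc O b) (hX : 𝒜.Inc X a) (hne : X ≠ O) : ¬ 𝒜.Inc X b :=
  fun h => hab (line_eq hne hX hOa h hOb)

/-- If `AB ∥ A'B'`, with `A, A'` and `B, B'` on two lines through `O` and `B, B' ≠ O`, then `A` and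
`A'` can equal `O` only simultaneously. -/
theorem eq_center_of_sameDir {O A B A' B' : Point} {a b : Line} (hab : a ≠ b)
    (hOa : 𝒜.Inc O a) (hOb : 𝒜.Inc O b) (hA' : 𝒜.Inc A' a)
    (hB : 𝒜.Inc B b) (hB' : 𝒜.Inc B' b) (hBO : B ≠ O) (hBO' : B' ≠ O)
    (hAB : 𝒜.SameDir A B A' B') (hAO : A = O) : A' = O := by
  subst hAO
  refine hAB.flip.eq_of_inc (.of_inc hB hOb hB' hOb) hBO ?_ hA' hOa
  exact not_inc_of_ne hab.symm hOb hOa hB' hBO'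

/-- Desargues' axiom for triangles in perspective from `O`, where the outer vertices may be `O`. -/
theorem sameDir_of_concurrent {O A B C A' B' C' : Point} {a b c : Line}
    (hab : a ≠ b) (hac : a ≠ c) (hbc : b ≠ c)
    (hOa : 𝒜.Inc O a) (hOb : 𝒜.Inc O b) (hOc : 𝒜.Inc O c)
    (hA : 𝒜.Inc A a) (hA' : 𝒜.Inc A' a) (hB : 𝒜.Inc B b) (hB' : 𝒜.Inc B' b)
    (hC : 𝒜.Inc C c) (hC' : 𝒜.Inc C' c) (hBO : B ≠ O) (hBO' : B' ≠ O)
    (hAB : 𝒜.SameDir A B A' B') (hBC : 𝒜.SameDir B C B' C') :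
    𝒜.SameDir A C A' C' := by
  have iA : A = O ↔ A' = O :=
    ⟨eq_center_of_sameDir hab hOa hOb hA' hB hB' hBO hBO' hAB,
      eq_center_of_sameDir hab hOa hOb hA hB' hB hBO' hBO hAB.symm⟩
  have iC : C = O ↔ C' = O :=
    ⟨eq_center_of_sameDir hbc.symm hOc hOb hC' hB hB' hBO hBO' hBC.flip,
      eq_center_of_sameDir hbc.symm hOc hOb hC hB' hB hBO' hBO hBC.symm.flip⟩
  by_cases nA : A = O
  · exact .of_inc (l := c) (nA ▸ hOc) hC (iA.1 nA ▸ hOc) hC'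
  by_cases nC : C = O
  · exact .of_inc (l := a) hA (nC ▸ hOa) hA' (iC.1 nC ▸ hOa)
  have nA' : A' ≠ O := fun h => nA (iA.2 h)
  exact sameDir_of_desargues hA hA' hB hB' hC hC'
    (not_inc_of_ne hab hOa hOb hA nA) (not_inc_of_ne hac hOa hOc hA nA)
    (not_inc_of_ne hab.symm hOb hOa hB hBO) (not_inc_of_ne hbc hOb hOc hB hBO)
    (not_inc_of_ne hac.symm hOc hOa hC nC) (not_inc_of_ne hbc.symm hOc hOb hC nC)
    (not_inc_of_ne hab hOa hOb hA' nA') (not_inc_of_ne hac hOa hOc hA' nA')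
    (not_inc_of_ne hbc hOb hOc hB' hBO')
    (Or.inr ⟨O, hOa, hOb, hOc⟩) hAB hBC

/-- Through the common point `O` of two distinct lines, each having a further point, there passes a
third line, and it has a further point. -/
theorem exists_third_line {O A B : Point} {a b : Line} (hab : a ≠ b)
    (hOa : 𝒜.Inc O a) (hOb : 𝒜.Inc O b) (hA : 𝒜.Inc A a) (hB : 𝒜.Inc B b) (hAO : A ≠ O)
    (hBO : B ≠ O) :
    ∃ (c : Line) (G : Point), c ≠ a ∧ c ≠ b ∧ 𝒜.Inc O c ∧ 𝒜.Inc G c ∧ G ≠ O := by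
  have hAb := not_inc_of_ne hab hOa hOb hA hAO
  have hBa := not_inc_of_ne hab.symm hOb hOa hB hBO
  have hne : A ≠ B := fun e => hAb (e ▸ hB)
  -- The fourth vertex `G` of the parallelogram with diagonal `AO` and side `AB` does the job.
  obtain ⟨G, hG, hAG⟩ := exists_inc_sameDir (𝒜 := 𝒜.toAffinePlane) (C := O) hB hAb
    (𝒜.par_parallel A b)
  have hGO : G ≠ O := by
    rintro rfl
    exact hAb ((𝒜.par_parallel A b).eq_of_inc hG hOb ▸ 𝒜.inc_par A b)
  have hp : 𝒜.Parallel (𝒜.join A B hne) (𝒜.join O G hGO.symm) :=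
    hAG.parallel hne hGO.symm (𝒜.join_left _) (𝒜.join_right _) (𝒜.join_left _) (𝒜.join_right _)
  refine ⟨𝒜.join O G hGO.symm, G, ?_, ?_, 𝒜.join_left _, 𝒜.join_right _, hGO⟩
  · intro e
    rw [e] at hp
    exact hBa (hp.eq_of_inc (𝒜.join_left _) hA ▸ 𝒜.join_right _)
  · intro e
    rw [e] at hp
    exact hAb (hp.eq_of_inc (𝒜.join_right _) hB ▸ 𝒜.join_left _)

/-- If three sides of a quadrangle `B J E K` with alternate vertices on two lines through `O` are
parallel to the corresponding sides of a second such quadrangle, then so is the fourth. -/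
theorem sameDir_of_two_lines {O B E J K B' E' J' K' : Point} {a b : Line} (hab : a ≠ b)
    (hOa : 𝒜.Inc O a) (hOb : 𝒜.Inc O b)
    (hB : 𝒜.Inc B a) (hB' : 𝒜.Inc B' a) (hE : 𝒜.Inc E a) (hE' : 𝒜.Inc E' a)
    (hJ : 𝒜.Inc J b) (hJ' : 𝒜.Inc J' b) (hK : 𝒜.Inc K b) (hK' : 𝒜.Inc K' b)
    (hBO : B ≠ O) (hBO' : B' ≠ O) (hJO : J ≠ O) (hJO' : J' ≠ O)
    (hBJ : 𝒜.SameDir B J B' J') (hBK : 𝒜.SameDir B K B' K') (hEJ : 𝒜.SameDir E J E' J') :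
    𝒜.SameDir E K E' K' := by
  obtain ⟨c, G, hca, hcb, hOc, hG, hGO⟩ := exists_third_line hab hOa hOb hB hJ hBO hJO
  have hBc := not_inc_of_ne hca.symm hOa hOc hB hBO
  obtain ⟨G', hG', hBG⟩ := exists_inc_sameDir (𝒜 := 𝒜.toAffinePlane) (C := B') hG hBc
    (Parallel.refl c)
  have hGO' : G' ≠ O := fun h =>
    hGO (eq_center_of_sameDir hca hOc hOa hG hB' hB hBO' hBO hBG.symm.flip h)
  have hGJ := sameDir_of_concurrent hca hcb hab hOc hOa hOb hG hG' hB hB' hJ hJ' hBO hBO'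
    hBG.flip hBJ
  have hGK := sameDir_of_concurrent hca hcb hab hOc hOa hOb hG hG' hB hB' hK hK' hBO hBO'
    hBG.flip hBK
  have hEG := sameDir_of_concurrent hab hca.symm hcb.symm hOa hOb hOc hE hE' hJ hJ' hG hG'
    hJO hJO' hEJ hGJ.flip
  exact sameDir_of_concurrent hca.symm hab hcb hOa hOc hOb hE hE' hG hG' hK hK' hGO hGO' hEG hGK

end DesarguesAffinePlane

namespace LineFrame

open AffinePlane

/-! ### The constructions of sums and products -/

section Affine

variable {Point : Type*} {Line : Type*} {𝒜 : AffinePlane Point Line} {F : LineFrame 𝒜}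

theorem O_inc_lineOB₁ : 𝒜.Inc F.O F.lineOB₁ := 𝒜.join_left _

theorem B₁_inc_lineOB₁ : 𝒜.Inc F.B₁ F.lineOB₁ := 𝒜.join_right _

theorem line_ne_lineOB₁ : F.line ≠ F.lineOB₁ := fun e => F.B₁_not_inc (e ▸ B₁_inc_lineOB₁)

theorem val_ne_O {A : F.Pt} (hA : A ≠ 0) : A.1 ≠ F.O := fun e => hA (Subtype.ext e)

theorem eq_O_of_inc {X : Point} (h : 𝒜.Inc X F.line) (h' : 𝒜.Inc X F.lineOB₁) : X = F.O := by
  by_contra hne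
  exact line_ne_lineOB₁ (line_eq hne h F.O_inc h' O_inc_lineOB₁)

theorem close_sameDir (P₁ : Point) (B : F.Pt) :
    𝒜.SameDir (F.close P₁ B).1 P₁ B.1 F.B₁ :=
  ⟨_, _, 𝒜.meet_left (par_join_B₁_not_parallel B.2 P₁), 𝒜.inc_par _ _, 𝒜.join_left _,
    𝒜.join_right _, 𝒜.par_parallel _ _⟩

theorem eq_close {P₁ : Point} {B X : F.Pt} (h : 𝒜.SameDir X.1 P₁ B.1 F.B₁) :
    X = F.close P₁ B := by
  obtain ⟨l, m, hX, hP, hB, hB₁, hp⟩ := h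
  obtain rfl := line_eq (ne_B₁ B.2) hB hB₁ (𝒜.join_left (ne_B₁ B.2)) (𝒜.join_right _)
  obtain rfl := par_eq hP hp
  exact Subtype.ext (meet_eq (par_join_B₁_not_parallel B.2 P₁) hX X.2).symm

theorem close_injective {P₁ : Point} (h : ¬ 𝒜.Inc P₁ F.line) :
    Function.Injective (F.close P₁) := by
  intro B B' e
  have h1 := close_sameDir P₁ B
  have h2 := close_sameDir P₁ B'
  rw [← e] at h2
  exact Subtype.ext (h1.flip.eq_of_inc h2.flip (fun e' => h (e' ▸ (F.close P₁ B).2))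
    F.B₁_not_inc B.2 B'.2)

theorem mulP₁_inc (A : Point) : 𝒜.Inc (F.mulP₁ A) F.lineOB₁ := 𝒜.meet_right _

theorem mulP₁_sameDir (A : Point) : 𝒜.SameDir A (F.mulP₁ A) F.I F.B₁ :=
  ⟨_, _, 𝒜.inc_par _ _, 𝒜.meet_left _, 𝒜.join_left _, 𝒜.join_right _, 𝒜.par_parallel _ _⟩

theorem eq_mulP₁ {A X : Point} (hX : 𝒜.Inc X F.lineOB₁) (h : 𝒜.SameDir A X F.I F.B₁) :
    X = F.mulP₁ A := by
  obtain ⟨l, m, hA, hXl, hI, hB₁, hp⟩ := h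
  obtain rfl := line_eq (ne_B₁ F.I_inc) hI hB₁ (𝒜.join_left (ne_B₁ F.I_inc)) (𝒜.join_right _)
  obtain rfl := par_eq hA hp
  exact (meet_eq _ hXl hX).symm

theorem mulP₁_zero : F.mulP₁ F.O = F.O :=
  (eq_mulP₁ O_inc_lineOB₁ ⟨_, _, 𝒜.inc_par _ F.lineIB₁, 𝒜.inc_par _ _, 𝒜.join_left _,
    𝒜.join_right _, 𝒜.par_parallel _ _⟩).symm

theorem mulP₁_one : F.mulP₁ F.I = F.B₁ :=
  (eq_mulP₁ B₁_inc_lineOB₁ (.of_inc (𝒜.join_left (ne_B₁ F.I_inc)) (𝒜.join_right _)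
    (𝒜.join_left _) (𝒜.join_right _))).symm

theorem mulP₁_injective {A B : F.Pt} (h : F.mulP₁ A.1 = F.mulP₁ B.1) : A = B := by
  have h1 := mulP₁_sameDir (F := F) A.1
  have h2 := mulP₁_sameDir (F := F) B.1
  rw [← h] at h2
  obtain ⟨l, m, hA, hPl, hI, hB₁, hp⟩ := h1
  obtain ⟨l', m', hB, hPl', hI', hB₁', hp'⟩ := h2
  obtain rfl := line_eq (ne_B₁ F.I_inc) hI hB₁ hI' hB₁'
  obtain rfl := (hp.trans hp'.symm).eq_of_inc hPl hPl'
  by_contra hne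
  have e : l = F.line := line_eq (fun e => hne (Subtype.ext e)) hA hB A.2 B.2
  exact F.B₁_not_inc ((e ▸ hp).eq_of_inc F.I_inc hI ▸ hB₁)

theorem mulP₁_ne_O {A : F.Pt} (hA : A ≠ 0) : F.mulP₁ A.1 ≠ F.O := fun h =>
  hA (mulP₁_injective (B := 0) (h.trans mulP₁_zero.symm))

theorem mulP₁_not_inc {A : F.Pt} (hA : A ≠ 0) : ¬ 𝒜.Inc (F.mulP₁ A.1) F.line := fun h =>
  mulP₁_ne_O hA (eq_O_of_inc h (mulP₁_inc _))

theorem mul_sameDir (A B : F.Pt) : 𝒜.SameDir (A * B).1 (F.mulP₁ A.1) B.1 F.B₁ :=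
  close_sameDir _ _

theorem mul_left_injective_of_ne_zero {A : F.Pt} (hA : A ≠ 0) :
    Function.Injective (A * ·) :=
  close_injective (mulP₁_not_inc hA)

theorem mul_zero' (A : F.Pt) : A * 0 = 0 :=
  (eq_close (.of_inc O_inc_lineOB₁ (mulP₁_inc _) O_inc_lineOB₁ B₁_inc_lineOB₁)).symm

theorem one_mul' (A : F.Pt) : 1 * A = A := by
  refine (eq_close ?_).symm
  rw [show F.mulP₁ (1 : F.Pt).1 = F.B₁ from mulP₁_one]
  exact .of_inc (𝒜.join_left (ne_B₁ A.2)) (𝒜.join_right _) (𝒜.join_left _) (𝒜.join_right _)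

theorem mul_ne_zero' {A B : F.Pt} (hA : A ≠ 0) (hB : B ≠ 0) : A * B ≠ 0 := fun h =>
  hB (mul_left_injective_of_ne_zero hA (h.trans (mul_zero' A).symm))

theorem addP₁_inc (A : Point) : 𝒜.Inc (F.addP₁ A) (𝒜.par F.B₁ F.line) := 𝒜.meet_left _

theorem addP₁_inc_par (A : Point) : 𝒜.Inc (F.addP₁ A) (𝒜.par A F.lineOB₁) := 𝒜.meet_right _

theorem not_inc_par {X : Point} (hX : ¬ 𝒜.Inc X F.line) {Y : Point}
    (hY : 𝒜.Inc Y (𝒜.par X F.line)) : ¬ 𝒜.Inc Y F.line := fun h =>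
  hX ((𝒜.par_parallel X F.line).eq_of_inc hY h ▸ 𝒜.inc_par X F.line)

theorem addP₁_not_inc (A : Point) : ¬ 𝒜.Inc (F.addP₁ A) F.line :=
  not_inc_par F.B₁_not_inc (addP₁_inc A)

theorem add_sameDir (A B : F.Pt) : 𝒜.SameDir (A + B).1 (F.addP₁ A.1) B.1 F.B₁ :=
  close_sameDir _ _

theorem addP₁_zero : F.addP₁ F.O = F.B₁ :=
  meet_eq _ (𝒜.inc_par _ _) (by rw [par_eq O_inc_lineOB₁ (.refl _)]; exact B₁_inc_lineOB₁)

theorem zero_add' (A : F.Pt) : 0 + A = A := by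
  refine (eq_close ?_).symm
  rw [show F.addP₁ (0 : F.Pt).1 = F.B₁ from addP₁_zero]
  exact .of_inc (𝒜.join_left (ne_B₁ A.2)) (𝒜.join_right _) (𝒜.join_left _) (𝒜.join_right _)

theorem add_left_injective' (A : F.Pt) : Function.Injective (A + ·) :=
  close_injective (addP₁_not_inc _)

theorem add_neg (A : F.Pt) : A + -A = 0 := (F.exists_add_eq_zero A).choose_spec

theorem mul_inv {A : F.Pt} (hA : A ≠ 0) : A * A⁻¹ = 1 := by
  have h : A⁻¹ = (F.exists_mul_eq_one A hA).choose := dif_pos hA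
  rw [h]
  exact (F.exists_mul_eq_one A hA).choose_spec

theorem one_ne_zero' : (1 : F.Pt) ≠ 0 := fun h => F.O_ne_I (congrArg Subtype.val h).symm

theorem addP₁_injective {A B : F.Pt} (h : F.addP₁ A.1 = F.addP₁ B.1) : A = B := by
  have h1 := addP₁_inc_par (F := F) A.1
  have h2 := addP₁_inc_par (F := F) B.1
  rw [← h] at h2
  have hA := 𝒜.par_parallel A.1 F.lineOB₁
  have e := (hA.trans (𝒜.par_parallel B.1 F.lineOB₁).symm).eq_of_inc h1 h2
  by_contra hne
  have e' := line_eq (fun e' => hne (Subtype.ext e')) (𝒜.inc_par A.1 F.lineOB₁)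
    (e ▸ 𝒜.inc_par B.1 F.lineOB₁) A.2 B.2
  rw [e'] at hA
  exact line_ne_lineOB₁ (hA.eq_of_inc F.O_inc O_inc_lineOB₁)

theorem add_right_cancel_zero {A B X : F.Pt} (hA : A + X = 0) (hB : B + X = 0) : A = B := by
  have h1 := add_sameDir A X
  have h2 := add_sameDir B X
  rw [hA] at h1
  rw [hB] at h2
  -- Both auxiliary points lie on the parallel to `X B₁` through `O`.
  exact addP₁_injective (h1.symm.eq_of_inc h2.symm (ne_B₁ X.2)
    (fun h => F.B₁_not_inc
      ((𝒜.par_parallel F.B₁ F.line).eq_of_inc h F.O_inc ▸ 𝒜.inc_par F.B₁ F.line))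
    (addP₁_inc _) (addP₁_inc _))

theorem sub_ne_zero' {A B : F.Pt} (h : A ≠ B) : A - B ≠ 0 := fun h' =>
  h (add_right_cancel_zero (X := -B) h' (add_neg B))

end Affine

/-! ### Associativity and left distributivity -/

section Desargues

open DesarguesAffinePlane

variable {Point : Type*} {Line : Type*} {𝒜 : DesarguesAffinePlane Point Line}
  {F : LineFrame 𝒜.toAffinePlane}

theorem mul_assoc_of_ne_zero {A B : F.Pt} (hA : A ≠ 0) (hB : B ≠ 0) (C : F.Pt) :
    A * B * C = A * (B * C) := by
  have hAB := mul_ne_zero' hA hB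
  -- The homothety of `A` sends `B` to `A * B`, hence `mulP₁ B` to `mulP₁ (A * B)`.
  have h : 𝒜.SameDir (B * C).1 (F.mulP₁ B.1) (A * (B * C)).1 (F.mulP₁ (A * B).1) :=
    sameDir_of_two_lines line_ne_lineOB₁ F.O_inc O_inc_lineOB₁ B.2 (A * B).2 (B * C).2
      (A * (B * C)).2 B₁_inc_lineOB₁ (mulP₁_inc A.1) (mulP₁_inc B.1) (mulP₁_inc _)
      (val_ne_O hB) (val_ne_O hAB) (ne_B₁ F.O_inc).symm (mulP₁_ne_O hA)
      (mul_sameDir A B).symm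
      ((mulP₁_sameDir B.1).trans (mulP₁_sameDir (A * B).1).symm (ne_B₁ F.I_inc))
      (mul_sameDir A (B * C)).symm
  exact (eq_close (h.symm.trans (mul_sameDir B C)
    fun e => mulP₁_not_inc hB (e ▸ (B * C).2))).symm

theorem mul_add_of_ne_zero {P : F.Pt} (hP : P ≠ 0) (X Y : F.Pt) :
    P * (X + Y) = P * X + P * Y := by
  by_cases hX : X = 0
  · rw [hX, zero_add', mul_zero', zero_add']
  by_cases hP1 : P = 1
  · simp only [hP1, one_mul']
  have hP'l := mulP₁_not_inc hP
  have hPX := mul_ne_zero' hP hX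
  have hX1l := addP₁_not_inc (F := F) X.1
  have hX1m : ¬ 𝒜.Inc (F.addP₁ X.1) F.lineOB₁ := fun h => by
    have e := (𝒜.par_parallel X.1 F.lineOB₁).eq_of_inc (addP₁_inc_par _) h
    exact val_ne_O hX (eq_O_of_inc X.2 (e ▸ 𝒜.inc_par X.1 F.lineOB₁))
  have hX1O : F.O ≠ F.addP₁ X.1 := fun e => hX1l (e ▸ F.O_inc)
  have hX1B : F.addP₁ X.1 ≠ F.B₁ := fun e => hX1m (e ▸ B₁_inc_lineOB₁)
  obtain ⟨k, hk⟩ : ∃ k, k = 𝒜.join F.O (F.addP₁ X.1) hX1O := ⟨_, rfl⟩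
  have hOk : 𝒜.Inc F.O k := hk ▸ 𝒜.join_left _
  have hX1k : 𝒜.Inc (F.addP₁ X.1) k := hk ▸ 𝒜.join_right _
  have hkl : k ≠ F.line := fun e => hX1l (e ▸ hX1k)
  have hkm : k ≠ F.lineOB₁ := fun e => hX1m (e ▸ hX1k)
  -- `X2` is the image of `addP₁ X` under the homothety of `P`, which sends `B₁` to `mulP₁ P`.
  have hnp : ¬ 𝒜.Parallel (𝒜.par (F.mulP₁ P.1) F.line) k := fun h =>
    hkl (((𝒜.par_parallel _ _).symm.trans h).eq_of_inc F.O_inc hOk).symm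
  obtain ⟨X2, ⟨hX2n, hX2k⟩, -⟩ := existsUnique_meet hnp
  have hX2l := not_inc_par hP'l hX2n
  have hX2 : 𝒜.SameDir (F.addP₁ X.1) F.B₁ X2 (F.mulP₁ P.1) :=
    ⟨_, _, addP₁_inc _, 𝒜.inc_par _ _, hX2n, 𝒜.inc_par _ _,
      (𝒜.par_parallel _ _).trans (𝒜.par_parallel _ _).symm⟩
  have key (Z : F.Pt) : 𝒜.SameDir (F.addP₁ X.1) Z.1 X2 (P * Z).1 :=
    sameDir_of_concurrent hkm hkl line_ne_lineOB₁.symm hOk O_inc_lineOB₁ F.O_inc hX1k hX2k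
      B₁_inc_lineOB₁ (mulP₁_inc _) Z.2 (P * Z).2 (ne_B₁ F.O_inc).symm (mulP₁_ne_O hP) hX2
      (mul_sameDir P Z).flip.symm
  have hX2m : 𝒜.Inc X2 (𝒜.par (P * X).1 F.lineOB₁) := by
    obtain ⟨r, s, hr1, hr2, hs1, hs2, hp⟩ := key X
    obtain rfl := line_eq (fun e : F.addP₁ X.1 = X.1 => hX1l (by rw [e]; exact X.2)) hr1
      hr2 (addP₁_inc_par X.1) (𝒜.inc_par _ _)
    rw [par_eq hs2 (hp.symm.trans (𝒜.par_parallel _ _))]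
    exact hs1
  -- So the points `X2` and `mulP₁ P` construct `P * (X + Y)` from `P * X` and `P * Y`, just as
  -- `addP₁ (P * X)` and `B₁` construct the sum.
  have hY : 𝒜.SameDir (P * Y).1 (F.mulP₁ P.1) (P * (X + Y)).1 X2 :=
    ((mul_sameDir P Y).trans (add_sameDir X Y).symm (ne_B₁ Y.2)).trans (key (X + Y)).flip
      fun e => hX1l (e ▸ (X + Y).2)
  have hPB : F.mulP₁ P.1 ≠ F.B₁ := fun e =>
    hP1 (mulP₁_injective (B := 1) (e.trans mulP₁_one.symm))
  have hQ : 𝒜.SameDir (F.mulP₁ P.1) F.B₁ X2 (F.addP₁ (P * X).1) :=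
    ⟨_, _, mulP₁_inc _, B₁_inc_lineOB₁, hX2m, addP₁_inc_par _, (𝒜.par_parallel _ _).symm⟩
  -- The parallels to `OI` through `mulP₁ P` and `B₁` differ, as `OB₁` meets each of them once.
  have hnn : 𝒜.par (F.mulP₁ P.1) F.line ≠ 𝒜.par F.B₁ F.line := fun e => by
    have e1 := line_eq hPB (𝒜.inc_par (F.mulP₁ P.1) F.line) (e ▸ 𝒜.inc_par F.B₁ F.line)
      (mulP₁_inc _) B₁_inc_lineOB₁
    exact not_inc_par hP'l (e1 ▸ O_inc_lineOB₁) F.O_inc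
  have hpar : 𝒜.Parallel (𝒜.par (F.mulP₁ P.1) F.line) (𝒜.par F.B₁ F.line) :=
    (𝒜.par_parallel _ _).trans (𝒜.par_parallel _ _).symm
  refine eq_close ?_
  refine SameDir.symm (sameDir_of_desargues (P * Y).2 (P * (X + Y)).2 (𝒜.inc_par _ _) hX2n
    (𝒜.inc_par _ _) (addP₁_inc _) ?_ ?_ hP'l ?_ F.B₁_not_inc ?_ ?_ ?_ ?_
    (Or.inl ⟨(𝒜.par_parallel _ _).symm, hpar⟩) hY hQ)
  · exact fun h => not_inc_par hP'l h (P * Y).2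
  · exact fun h => not_inc_par F.B₁_not_inc h (P * Y).2
  · exact fun h => hnn (hpar.eq_of_inc (𝒜.inc_par _ _) h)
  · exact fun h => hnn (hpar.eq_of_inc h (𝒜.inc_par _ _))
  · exact fun h => not_inc_par hP'l h (P * (X + Y)).2
  · exact fun h => not_inc_par F.B₁_not_inc h (P * (X + Y)).2
  · exact fun h => hnn (hpar.eq_of_inc hX2n h)

theorem mul_sub_of_ne_zero {P : F.Pt} (hP : P ≠ 0) (X Y : F.Pt) :
    P * (X - Y) = P * X - P * Y := by
  have hneg : P * -Y = -(P * Y) := by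
    refine add_left_injective' (P * Y) ?_
    change P * Y + P * -Y = P * Y + -(P * Y)
    rw [← mul_add_of_ne_zero hP, add_neg, mul_zero', add_neg]
  change P * (X + -Y) = P * X + -(P * Y)
  rw [mul_add_of_ne_zero hP, hneg]

theorem inv_ne_zero' {X : F.Pt} (hX : X ≠ 0) : X⁻¹ ≠ 0 := fun h =>
  one_ne_zero' ((mul_inv hX).symm.trans (h ▸ mul_zero' X))

theorem mul_inv_mul {X : F.Pt} (hX : X ≠ 0) (Y : F.Pt) : X * (X⁻¹ * Y) = Y := by
  rw [← mul_assoc_of_ne_zero hX (inv_ne_zero' hX), mul_inv hX, one_mul']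

theorem inv_mul_mul_left {P X : F.Pt} (hP : P ≠ 0) (hX : X ≠ 0) (Y : F.Pt) :
    (P * X)⁻¹ * (P * Y) = X⁻¹ * Y := by
  have hPX := mul_ne_zero' hP hX
  refine mul_left_injective_of_ne_zero hPX ?_
  change P * X * ((P * X)⁻¹ * (P * Y)) = P * X * (X⁻¹ * Y)
  rw [mul_inv_mul hPX, mul_assoc_of_ne_zero hP hX, mul_inv_mul hX]

end Desargues

end LineFrame

theorem mainTheorem8 {Point : Type*} {Line : Type*} (𝒜 : DesarguesAffinePlane Point Line)
    (F : LineFrame 𝒜.toAffinePlane) (P : F.Pt) (hP : P ≠ 0) (A B C : F.Pt) (hBC : B ≠ C) :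
    LineFrame.inversion P B ≠ LineFrame.inversion P C ∧
      LineFrame.ratio (LineFrame.inversion P A) (LineFrame.inversion P B)
        (LineFrame.inversion P C) = LineFrame.ratio A B C := by
  refine ⟨fun h => hBC (LineFrame.mul_left_injective_of_ne_zero hP h), ?_⟩
  simp only [LineFrame.ratio, LineFrame.inversion]
  rw [← LineFrame.mul_sub_of_ne_zero hP, ← LineFrame.mul_sub_of_ne_zero hP,
    LineFrame.inv_mul_mul_left hP (LineFrame.sub_ne_zero' hBC)]
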